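/- Let $\mathcal K$ be a category. An object $M$ of $\mathcal K$ is finitely presentable if $\mathrm{Hom}(M,-)$ preserves directed colimits. The category $\mathcal K$ is locally finitely presentable if it is cocomplete and has a set $\mathcal A$ of finitely presentable objects such that every object of $\mathcal K$ is a directed colimit of objects from $\mathcal A$. A morphism $h\colon K\to L$ is pure if, for all morphisms $f\colon M\to N$, $u\colon M\to K$, $v\colon N\to L$ with $M$ and $N$ finitely presentable and $hu=vf$, there is a morphism $g\colon N\to K$ with $gf=u$; a pure monomorphism is a monomorphism that is pure. (In a locally finitely presentable category every pure morphism is a monomorphism.) A class of morphisms is cofibrantly closed if it is closed under pushouts along arbitrary morphisms, under transfinite compositions (of smooth chains of arbitrary ordinal length, including length $0$), and under retracts in the category of morphisms of $\mathcal K$. Theorem. In every locally finitely presentable additive category $\mathcal K$, the class of pure monomorphisms is cofibrantly generated: there is a set $\mathcal X$ of morphisms of $\mathcal K$ such that the class of pure monomorphisms is exactly the closure of $\mathcal X$ under pushouts, transfinite compositions and retracts, that is, the smallest cofibrantly closed class of morphisms containing $\mathcal X$. In particular, this holds for the category of all (left) modules over any ring $R$. -/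

import Mathlib

open CategoryTheory Limits

universe w v u

/-- A morphism `h : K ⟶ L` is pure if for every commutative square `u ≫ h = f ≫ v` with
`f : M ⟶ N` a morphism between finitely presentable objects, `u` factors through `f`. -/
def CategoryTheory.IsPure {C : Type u} [Category.{v} C] {K L : C} (h : K ⟶ L) : Prop :=
  ∀ ⦃M N : C⦄, IsFinitelyPresentable.{w} M → IsFinitelyPresentable.{w} N →
    ∀ (f : M ⟶ N) (u : M ⟶ K) (v : N ⟶ L), u ≫ h = f ≫ v → ∃ g : N ⟶ K, f ≫ g = u

namespace CategoryTheory.MorphismProperty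

/-- The class of pure monomorphisms of `C`. -/
def pureMonomorphisms (C : Type u) [Category.{v} C] : MorphismProperty C :=
  fun _ _ h => IsPure.{w} h ∧ Mono h

/-- A class of morphisms is cofibrantly closed if it is closed under pushouts,
transfinite compositions (of arbitrary `w`-small well-ordered shape, including the
empty composition) and retracts in the category of morphisms. -/
structure IsCofibrantlyClosed {C : Type u} [Category.{v} C] (W : MorphismProperty C) : Prop where
  pushout : W.IsStableUnderCobaseChange
  transfiniteComposition : IsStableUnderTransfiniteComposition.{w} W
  retract : W.IsStableUnderRetracts

/-- The closure of a class of morphisms under pushouts, transfinite compositions and retracts: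
the smallest cofibrantly closed class containing it. -/
def cofibrantClosure {C : Type u} [Category.{v} C] (X : MorphismProperty C) :
    MorphismProperty C :=
  fun _ _ f => ∀ W : MorphismProperty C, IsCofibrantlyClosed.{w} W → X ≤ W → W f

/-- A class of morphisms is cofibrantly generated if it is the closure of a (small) set of
morphisms under pushouts, transfinite compositions and retracts. -/
def IsCofibrantlyGenerated {C : Type u} [Category.{v} C] (W : MorphismProperty C) : Prop :=
  ∃ X : MorphismProperty C, IsSmall.{w} X ∧ cofibrantClosure.{w} X = W

end CategoryTheory.MorphismProperty

/-! The finitely presentable objects are dense, so an object is determined by its presheaf of maps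
from a small family `G` of them, and flat presheaves on `G` are representable. Pure monomorphisms
into `L` become pure additive subfunctors of the presheaf of `L`. Such a subfunctor and its quotient
are both flat, hence represented (`IsPureSub.exists_subobject`, `IsPureSub.exists_quotient`), so
every pure `K ⟶ L` extends to a sequence `K ⟶ L ⟶ S` that is exact on maps from `G`.

For each `S` there is such a sequence `N ⟶ P ⟶ S` with `P` a coproduct of members of `G`. Since `P`
lifts against pure epimorphisms, every pure monomorphism with quotient `S` is a pushout of `N ⟶ P`
(`IsPureExact.exists_isPushout`). Fix a large regular `κ`, and let `X` consist of the maps `N ⟶ P`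
for representatives `S` of the `κ`-presentable objects.

A Löwenheim–Skolem argument puts every element of `L/K` in a small pure subfunctor. Iterating, `K ⟶
L` is a transfinite composition of pure monomorphisms with `κ`-presentable quotients, that is, of
pushouts of `X`. Conversely, pure monomorphisms are cofibrantly closed; the delicate case is
pushouts (`IsPure.of_isPushout`). -/

namespace CategoryTheory

/-! ### Density and closure properties of the finitely presentable objects -/

variable {C : Type u} [Category.{w} C]

/-- A family of finitely presentable objects which meets every isomorphism class of
finitely presentable objects. -/
structure IsFPFamily {A : Type w} (G : A → C) : Prop where
  isFinitelyPresentable (a : A) : IsFinitelyPresentable.{w} (G a)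
  exists_iso (M : C) [IsFinitelyPresentable.{w} M] : ∃ a, Nonempty (M ≅ G a)

lemma exists_isFPFamily [IsLocallyFinitelyPresentable.{w} C] :
    ∃ (A : Type w) (G : A → C), IsFPFamily G := by
  obtain ⟨Q, _, hQ, hQ'⟩ := ObjectProperty.EssentiallySmall.exists_small_le.{w}
    (ObjectProperty.isFinitelyPresentable.{w} C)
  refine ⟨Shrink.{w} (Subtype Q), fun a ↦ ((equivShrink _).symm a).1, fun a ↦ ?_, fun M hM ↦ ?_⟩
  · exact hQ _ ((equivShrink _).symm a).2
  · obtain ⟨N, hN, ⟨e⟩⟩ := hQ' M hM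
    exact ⟨equivShrink _ ⟨N, hN⟩, ⟨e ≪≫ eqToIso (by simp)⟩⟩

namespace IsFPFamily

variable {A : Type w} {G : A → C} (hG : IsFPFamily G)

include hG

section

variable [IsLocallyFinitelyPresentable.{w} C]

lemma hom_ext {X Y : C} {f g : X ⟶ Y} (h : ∀ a (x : G a ⟶ X), x ≫ f = x ≫ g) : f = g := by
  let P := ObjectProperty.isFinitelyPresentable.{w} C
  refine IsColimit.hom_ext (P.ι.denseAt X) (fun p ↦ ?_)
  have : IsFinitelyPresentable.{w} p.left.1 := p.left.2
  obtain ⟨a, ⟨e⟩⟩ := hG.exists_iso p.left.1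
  have key : (show p.left.1 ⟶ X from p.hom) ≫ f = (show p.left.1 ⟶ X from p.hom) ≫ g := by
    rw [← cancel_epi e.inv]
    simpa using h a (e.inv ≫ p.hom)
  have hid := Category.id_comp (show p.left.1 ⟶ X from p.hom)
  exact (congr_arg (· ≫ f) hid).trans (key.trans (congr_arg (· ≫ g) hid).symm)

lemma exists_hom {X Y : C} (φ : ∀ a, (G a ⟶ X) → (G a ⟶ Y))
    (hφ : ∀ a b (f : G a ⟶ G b) (x : G b ⟶ X), φ a (f ≫ x) = f ≫ φ b x) :
    ∃ f : X ⟶ Y, ∀ a x, x ≫ f = φ a x := by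
  let P := ObjectProperty.isFinitelyPresentable.{w} C
  have (M : P.FullSubcategory) : IsFinitelyPresentable.{w} M.1 := M.2
  choose i e using fun M : P.FullSubcategory ↦ hG.exists_iso M.1
  let e' := fun M ↦ (e M).some
  let c : Cocone (CostructuredArrow.proj P.ι X ⋙ P.ι) :=
    { pt := Y
      ι :=
        { app g := (e' g.left).hom ≫ φ _ ((e' g.left).inv ≫ g.hom)
          naturality g₁ g₂ t := by
            have := hφ _ _ ((e' g₁.left).inv ≫ t.left.hom ≫ (e' g₂.left).hom)
              ((e' g₂.left).inv ≫ g₂.hom)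
            have ht : t.left.hom ≫ g₂.hom = g₁.hom := CostructuredArrow.w t
            simp only [Category.assoc, Iso.hom_inv_id_assoc, ht] at this
            simp only [Functor.comp_map, CostructuredArrow.proj_map, Functor.const_obj_map, this]
            exact ((Category.comp_id _).trans (Iso.hom_inv_id_assoc (e' g₁.left) _)).symm } }
  refine ⟨(P.ι.denseAt X).desc c, fun a x ↦ ?_⟩
  let M : P.FullSubcategory := ⟨G a, hG.isFinitelyPresentable a⟩
  have h := (P.ι.denseAt X).fac c (CostructuredArrow.mk (S := P.ι) (Y := M) x)
  have h' := hφ _ _ (e' M).hom ((e' M).inv ≫ x)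
  rw [Iso.hom_inv_id_assoc] at h'
  exact (congr_arg (· ≫ (P.ι.denseAt X).desc c) (Category.id_comp x)).symm.trans (h.trans h'.symm)

/-- Because `j` is mono, lifts chosen element by element are unique, hence natural, and density
assembles them into a morphism. -/
lemma exists_lift {X Y L : C} (g : X ⟶ L) (j : Y ⟶ L) [Mono j]
    (h : ∀ a (x : G a ⟶ X), ∃ y, y ≫ j = x ≫ g) : ∃ k : X ⟶ Y, k ≫ j = g := by
  choose φ hφ using h
  obtain ⟨k, hk⟩ := hG.exists_hom φ (fun a b f x ↦ by simp [← cancel_mono j, hφ])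
  exact ⟨k, hG.hom_ext fun a x ↦ by rw [← Category.assoc, hk, hφ]⟩

lemma mono_of_injective {X Y : C} (f : X ⟶ Y)
    (h : ∀ a (x y : G a ⟶ X), x ≫ f = y ≫ f → x = y) : Mono f where
  right_cancellation g g' e := hG.hom_ext fun a x ↦ h _ _ _ (by simp [e])

/-- Recognises unions of subobjects as colimits; this gives continuity of the chain at limit stages.
-/
lemma nonempty_isColimit {J : Type*} [Category* J] [IsFiltered J] {F : J ⥤ C} (c : Cocone F)
    [∀ j, Mono (c.ι.app j)] (h : ∀ a (x : G a ⟶ c.pt), ∃ j y, y ≫ c.ι.app j = x) :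
    Nonempty (IsColimit c) := by
  choose i y hy using h
  have key (s : Cocone F) {a : A} {j k : J} (p : G a ⟶ F.obj j) (q : G a ⟶ F.obj k)
      (hpq : p ≫ c.ι.app j = q ≫ c.ι.app k) : p ≫ s.ι.app j = q ≫ s.ι.app k := by
    have : p ≫ F.map (IsFiltered.leftToMax j k) = q ≫ F.map (IsFiltered.rightToMax j k) := by
      rw [← cancel_mono (c.ι.app (IsFiltered.max j k))]
      simpa using hpq
    rw [← s.w (IsFiltered.leftToMax j k), ← s.w (IsFiltered.rightToMax j k), reassoc_of% this]
  have (s : Cocone F) := hG.exists_hom (X := c.pt) (Y := s.pt)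
    (fun a x ↦ y a x ≫ s.ι.app _) (fun a b f x ↦ by
      rw [← Category.assoc]
      exact key s _ _ (by simp [hy]))
  choose d hd using this
  exact ⟨{
    desc := d
    fac s j := hG.hom_ext fun a x ↦ by
      rw [← Category.assoc, hd]
      exact key s _ _ (hy _ _)
    uniq s m hm := hG.hom_ext fun a x ↦ by
      rw [hd, ← hm, reassoc_of% (hy a x)] }⟩

end

section

variable [Preadditive C] [HasFiniteBiproducts C] [IsLocallyFinitelyPresentable.{w} C]

omit hG in
lemma _root_.CategoryTheory.hasFiniteColimits_of_isLocallyFinitelyPresentable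
    (C : Type u) [Category.{w} C] [IsLocallyFinitelyPresentable.{w} C] : HasFiniteColimits C :=
  have : HasColimitsOfSize.{0, 0} C := hasColimitsOfSizeShrink.{0, 0, w, w} C
  ⟨fun _ _ _ ↦ inferInstance⟩

attribute [local instance] Cardinal.fact_isRegular_aleph0

omit [Preadditive C] [HasFiniteBiproducts C] in
lemma exists_iso_colimit {J : Type} [SmallCategory J] [FinCategory J] (F : J ⥤ C)
    (hF : ∀ j, ∃ a, F.obj j = G a) {c : Cocone F} (hc : IsColimit c) :
    ∃ b, Nonempty (c.pt ≅ G b) := by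
  have (j : J) : IsFinitelyPresentable.{w} (F.obj j) := by
    obtain ⟨a, ha⟩ := hF j
    rw [ha]
    exact hG.isFinitelyPresentable a
  have : IsFinitelyPresentable.{w} c.pt :=
    isCardinalPresentable_of_isColimit.{w} c hc Cardinal.aleph0.{w}
      (by rw [hasCardinalLT_aleph0_iff]; infer_instance)
  exact hG.exists_iso _

omit [HasFiniteBiproducts C] in
/-- The family is closed under cokernels. -/
lemma exists_cokernel {a b : A} (f : G a ⟶ G b) :
    ∃ (c : A) (e : G b ⟶ G c), f ≫ e = 0 ∧
      ∀ ⦃X : C⦄ (y : G b ⟶ X), f ≫ y = 0 → ∃ y' : G c ⟶ X, e ≫ y' = y := by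
  have := hasFiniteColimits_of_isLocallyFinitelyPresentable C
  obtain ⟨c, ⟨i⟩⟩ := hG.exists_iso_colimit (parallelPair f 0)
    (by rintro (_ | _); exacts [⟨_, rfl⟩, ⟨_, rfl⟩]) (cokernelIsCokernel f)
  replace i : cokernel f ≅ G c := i
  refine ⟨c, cokernel.π f ≫ i.hom, by simp, fun X y hy ↦ ⟨i.inv ≫ cokernel.desc f y hy, by simp⟩⟩

/-- The family is closed under binary biproducts. -/
lemma exists_biprod (a b : A) :
    ∃ (c : A) (inl : G a ⟶ G c) (inr : G b ⟶ G c) (fst : G c ⟶ G a) (snd : G c ⟶ G b),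
      inl ≫ fst = 𝟙 _ ∧ inl ≫ snd = 0 ∧ inr ≫ fst = 0 ∧ inr ≫ snd = 𝟙 _ := by
  have : HasBinaryBiproducts C := hasBinaryBiproducts_of_finite_biproducts C
  obtain ⟨c, ⟨i⟩⟩ := hG.exists_iso_colimit (pair (G a) (G b))
    (by rintro ⟨_ | _⟩; exacts [⟨_, rfl⟩, ⟨_, rfl⟩])
    (BinaryBiproduct.isColimit (G a) (G b))
  replace i : G a ⊞ G b ≅ G c := i
  exact ⟨c, biprod.inl ≫ i.hom, biprod.inr ≫ i.hom, i.inv ≫ biprod.fst, i.inv ≫ biprod.snd,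
    by simp, by simp, by simp, by simp⟩

end

end IsFPFamily

/-! ### Formal properties of pure morphisms -/

section

variable {K L : C} {h : K ⟶ L}

lemma IsPure.comp {L' : C} {h' : L ⟶ L'} (hh : IsPure.{w} h) (hh' : IsPure.{w} h') :
    IsPure.{w} (h ≫ h') := by
  intro M N hM hN f u v e
  obtain ⟨g, hg⟩ := hh' hM hN f (u ≫ h) v (by simpa using e)
  exact hh hM hN f u g hg.symm

lemma IsPure.of_comp {L' : C} {h' : L ⟶ L'} (hh : IsPure.{w} (h ≫ h')) : IsPure.{w} h := by
  intro M N hM hN f u v e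
  exact hh hM hN f u (v ≫ h') (by simp [reassoc_of% e])

lemma IsPure.of_isIso [IsIso h] : IsPure.{w} h := fun _ _ _ _ f u v e ↦
  ⟨v ≫ inv h, by rw [← Category.assoc, ← e, Category.assoc, IsIso.hom_inv_id, Category.comp_id]⟩

lemma IsPure.of_retract {K' L' : C} {h' : K' ⟶ L'} (r : RetractArrow h h')
    (hh : IsPure.{w} h') : IsPure.{w} h := by
  have : IsPure.{w} r.i.left := .of_comp (h' := r.r.left) (by
    rw [r.retract_left]
    exact .of_isIso (h := 𝟙 K))
  refine IsPure.of_comp (h' := r.i.right) ?_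
  have e := Arrow.w r.i
  dsimp at e
  rw [← e]
  exact this.comp hh

/-- A test square has finitely presentable corners, so it already lives and commutes at some stage
of the diagram. This yields closure under transfinite composition. -/
lemma IsPure.of_isColimit {J : Type w} [SmallCategory J] [IsFiltered J] {F F' : J ⥤ C}
    {c : Cocone F} {c' : Cocone F'} (hc : IsColimit c) (hc' : IsColimit c') (f : F ⟶ F')
    (hf : ∀ j, IsPure.{w} (f.app j)) (φ : c.pt ⟶ c'.pt)
    (hφ : ∀ j, c.ι.app j ≫ φ = f.app j ≫ c'.ι.app j) : IsPure.{w} φ := by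
  intro M N hM hN p u v e
  obtain ⟨i, u, rfl⟩ := IsFinitelyPresentable.exists_hom_of_isColimit hc u
  obtain ⟨j, v, rfl⟩ := IsFinitelyPresentable.exists_hom_of_isColimit hc' v
  obtain ⟨k, s, t, hst⟩ := IsFinitelyPresentable.exists_eq_of_isColimit hc'
    (u ≫ f.app i) (p ≫ v) (by simpa [hφ] using e)
  obtain ⟨g, hg⟩ := hf k hM hN p (u ≫ F.map s) (v ≫ F'.map t) (by simpa using hst)
  exact ⟨g ≫ c.ι.app k, by simp [reassoc_of% hg]⟩

variable [Preadditive C] [HasFiniteBiproducts C] [IsLocallyFinitelyPresentable.{w} C]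

omit [Preadditive C] [HasFiniteBiproducts C] [IsLocallyFinitelyPresentable.{w} C] in
lemma isFinitelyPresentable_of_isZero {Z : C} (hZ : IsZero Z) : IsFinitelyPresentable.{w} Z :=
  have : Fact Cardinal.aleph0.{w}.IsRegular := Cardinal.fact_isRegular_aleph0
  have (k : Discrete PEmpty.{1}) :
      IsCardinalPresentable ((Functor.empty.{0} C).obj k) Cardinal.aleph0.{w} := k.as.elim
  isCardinalPresentable_of_isColimit.{w} (asEmptyCocone Z) hZ.isInitial Cardinal.aleph0.{w}
    (by rw [hasCardinalLT_aleph0_iff]; infer_instance)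

omit [IsLocallyFinitelyPresentable.{w} C] in
lemma IsFPFamily.nonempty {A : Type w} {G : A → C} (hG : IsFPFamily G) : Nonempty A := by
  have : HasZeroObject C := hasZeroObject_of_hasFiniteBiproducts C
  obtain ⟨Z, hZ⟩ := HasZeroObject.zero (C := C)
  have := isFinitelyPresentable_of_isZero hZ
  obtain ⟨a, -⟩ := hG.exists_iso Z
  exact ⟨a⟩

lemma IsPure.mono (hh : IsPure.{w} h) : Mono h := by
  obtain ⟨A, G, hG⟩ := exists_isFPFamily (C := C)
  have : HasZeroObject C := hasZeroObject_of_hasFiniteBiproducts C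
  refine hG.mono_of_injective h fun a x y e ↦ ?_
  rw [← sub_eq_zero]
  obtain ⟨Z, hZ⟩ := HasZeroObject.zero (C := C)
  -- Purity against `G a ⟶ 0` forces `x - y`, which `h` kills, to factor through zero.
  obtain ⟨g, hg⟩ := hh (hG.isFinitelyPresentable a)
    (isFinitelyPresentable_of_isZero hZ) 0 (x - y) 0 (by simp [e])
  simpa using hg.symm

end

/-! ### Flat presheaves and their representability -/

variable {C : Type u} [Category.{w} C]

/-- A presheaf of types on the full subcategory spanned by a family of objects. -/
structure ElementSystem {A : Type w} (G : A → C) where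
  /-- the sections over a member of the family -/
  sec : A → Type w
  /-- the restriction maps -/
  res {a b : A} (f : G a ⟶ G b) : sec b → sec a
  res_id {a : A} (q : sec a) : res (𝟙 (G a)) q = q
  res_comp {a b c : A} (f : G a ⟶ G b) (g : G b ⟶ G c) (q : sec c) :
    res (f ≫ g) q = res f (res g q)

namespace ElementSystem

variable {A : Type w} {G : A → C} (Q : ElementSystem G)

/-- The category of elements of a presheaf. -/
@[ext]
structure Elt where
  /-- the index -/
  index : A
  /-- the section -/
  val : Q.sec index

variable {Q} in
/-- Morphisms in the category of elements. -/
@[ext]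
structure Elt.Hom (x y : Q.Elt) where
  /-- the underlying morphism -/
  hom : G x.index ⟶ G y.index
  res_eq : Q.res hom y.val = x.val

@[simps]
instance : SmallCategory Q.Elt where
  Hom x y := Elt.Hom x y
  id x := ⟨𝟙 _, Q.res_id _⟩
  comp f g := ⟨f.hom ≫ g.hom, by rw [Q.res_comp, g.res_eq, f.res_eq]⟩

/-- The projection of the category of elements. -/
@[simps]
def proj : Q.Elt ⥤ C where
  obj x := G x.index
  map f := f.hom

lemma hasCardinalLT_arrow_elt {κ : Cardinal.{w}} [Fact κ.IsRegular]
    (h₁ : HasCardinalLT (Σ a, Q.sec a) κ) (h₂ : HasCardinalLT (Σ a b, G a ⟶ G b) κ) :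
    HasCardinalLT (Arrow Q.Elt) κ := by
  have hκ : Cardinal.aleph0 ≤ κ := Cardinal.IsRegular.aleph0_le Fact.out
  refine (hasCardinalLT_prod hκ h₁ (hasCardinalLT_prod hκ h₁ h₂)).of_injective
    (fun f ↦ (⟨f.left.1, f.left.2⟩, ⟨f.right.1, f.right.2⟩, ⟨_, _, f.hom.hom⟩)) ?_
  rintro ⟨⟨a, x⟩, ⟨b, y⟩, ⟨f, hf⟩⟩ ⟨⟨a', x'⟩, ⟨b', y'⟩, ⟨f', hf'⟩⟩ h
  simp only [Prod.mk.injEq, Sigma.mk.injEq] at h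
  obtain ⟨⟨rfl, h₁⟩, ⟨rfl, h₂⟩, h₃⟩ := h
  obtain rfl := eq_of_heq h₁
  obtain rfl := eq_of_heq h₂
  simp only [heq_eq_eq, Sigma.mk.injEq, true_and] at h₃
  obtain rfl := h₃
  rfl

/-- The conditions which say that the category of elements is filtered. -/
structure IsFlat : Prop where
  nonempty : ∃ a, Nonempty (Q.sec a)
  exists_pair {a b : A} (q : Q.sec a) (r : Q.sec b) :
    ∃ (c : A) (f : G a ⟶ G c) (g : G b ⟶ G c) (s : Q.sec c), Q.res f s = q ∧ Q.res g s = r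
  exists_coeq {a b : A} (f g : G a ⟶ G b) (q : Q.sec b) : Q.res f q = Q.res g q →
    ∃ (c : A) (e : G b ⟶ G c) (s : Q.sec c), f ≫ e = g ≫ e ∧ Q.res e s = q

variable {Q}

lemma IsFlat.isFiltered (hQ : Q.IsFlat) : IsFiltered Q.Elt where
  nonempty := by
    obtain ⟨a, ⟨q⟩⟩ := hQ.nonempty
    exact ⟨⟨a, q⟩⟩
  cocone_objs x y := by
    obtain ⟨c, f, g, s, hf, hg⟩ := hQ.exists_pair x.val y.val
    exact ⟨⟨c, s⟩, ⟨f, hf⟩, ⟨g, hg⟩, trivial⟩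
  cocone_maps x y f g := by
    obtain ⟨c, e, s, he, hs⟩ := hQ.exists_coeq f.hom g.hom y.val (by rw [f.res_eq, g.res_eq])
    exact ⟨⟨c, s⟩, ⟨e, hs⟩, Elt.Hom.ext he⟩

/-- The representing object is the filtered colimit of the `G a` over the category of elements; maps
out of `G a` commute with it. A `κ`-small category of elements makes it `κ`-presentable. -/
lemma IsFlat.exists_representation [IsLocallyFinitelyPresentable.{w} C] (hQ : Q.IsFlat)
    (hG : IsFPFamily G) :
    ∃ (X : C) (ι : ∀ a, Q.sec a → (G a ⟶ X)), (∀ a, Function.Bijective (ι a)) ∧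
      (∀ a b (f : G a ⟶ G b) (q : Q.sec b), ι a (Q.res f q) = f ≫ ι b q) ∧
      ∀ (κ : Cardinal.{w}) [Fact κ.IsRegular], HasCardinalLT (Σ a, Q.sec a) κ →
        HasCardinalLT (Σ a b, G a ⟶ G b) κ → IsCardinalPresentable X κ := by
  have := hQ.isFiltered
  have (a : A) : IsFinitelyPresentable.{w} (G a) := hG.isFinitelyPresentable a
  have nat {a b : A} (f : G a ⟶ G b) (q : Q.sec b) :
      colimit.ι Q.proj ⟨a, Q.res f q⟩ = f ≫ colimit.ι Q.proj ⟨b, q⟩ := by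
    let φ : (⟨a, Q.res f q⟩ : Q.Elt) ⟶ ⟨b, q⟩ := ⟨f, rfl⟩
    exact (colimit.w Q.proj φ).symm
  refine ⟨colimit Q.proj, fun a q ↦ colimit.ι Q.proj ⟨a, q⟩, fun a ↦ ⟨fun q r h ↦ ?_, fun x ↦ ?_⟩,
    fun a b f q ↦ nat f q, fun κ _ h₁ h₂ ↦ ?_⟩
  · obtain ⟨k, s, t, h⟩ := IsFinitelyPresentable.exists_eq_of_isColimit
      (colimit.isColimit Q.proj) (X := G a) (i := ⟨a, q⟩) (j := ⟨a, r⟩) (𝟙 (G a)) (𝟙 (G a))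
      (congr_arg (𝟙 (G a) ≫ ·) h)
    have h : s.hom = t.hom := (Category.id_comp _).symm.trans (h.trans (Category.id_comp _))
    exact s.res_eq.symm.trans ((congr_arg (Q.res · k.val) h).trans t.res_eq)
  · obtain ⟨⟨b, q⟩, p, rfl⟩ := IsFinitelyPresentable.exists_hom_of_isColimit
      (colimit.isColimit Q.proj) x
    exact ⟨Q.res p q, nat p q⟩
  · have : Fact Cardinal.aleph0.{w}.IsRegular := Cardinal.fact_isRegular_aleph0
    have hκ : Cardinal.aleph0 ≤ κ := Cardinal.IsRegular.aleph0_le Fact.out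
    have (x : Q.Elt) : IsCardinalPresentable (Q.proj.obj x) κ :=
      isCardinalPresentable_of_le (κ := Cardinal.aleph0.{w}) (G x.index) hκ
    exact isCardinalPresentable_of_isColimit.{w} _ (colimit.isColimit Q.proj) κ
      (Q.hasCardinalLT_arrow_elt h₁ h₂)

end ElementSystem

/-! ### Pure subfunctors, their subobjects and quotients -/

section

variable [Preadditive C]

/-- A family of sets of morphisms to `L` which is the restriction of a pure
additive subfunctor of the functor represented by `L`. -/
structure IsPureSub {A : Type w} {G : A → C} {L : C} (T : ∀ a, Set (G a ⟶ L)) : Prop where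
  zero_mem (a : A) : 0 ∈ T a
  add_mem {a : A} {x y : G a ⟶ L} : x ∈ T a → y ∈ T a → x + y ∈ T a
  comp_mem {a b : A} (f : G a ⟶ G b) {x : G b ⟶ L} : x ∈ T b → f ≫ x ∈ T a
  exists_eq {a b : A} (f : G a ⟶ G b) (x : G b ⟶ L) : f ≫ x ∈ T a → ∃ y ∈ T b, f ≫ y = f ≫ x

/-- The morphisms from the members of the family `G` which factor through `h`. -/
def elementImage {A : Type w} (G : A → C) {K L : C} (h : K ⟶ L) (a : A) : Set (G a ⟶ L) :=
  Set.range (· ≫ h)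

omit [Preadditive C] in
@[simp]
lemma mem_elementImage {A : Type w} {G : A → C} {K L : C} {h : K ⟶ L} {a : A} {x : G a ⟶ L} :
    x ∈ elementImage G h a ↔ ∃ y, y ≫ h = x := Iff.rfl

variable {A : Type w} {G : A → C} (hG : IsFPFamily G)

include hG in
lemma IsPure.isPureSub {K L : C} {h : K ⟶ L} (hh : IsPure.{w} h) :
    IsPureSub (elementImage G h) where
  zero_mem a := ⟨0, by simp⟩
  add_mem := by
    rintro a _ _ ⟨x, rfl⟩ ⟨y, rfl⟩
    exact ⟨x + y, by simp⟩
  comp_mem := by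
    rintro a b f _ ⟨x, rfl⟩
    exact ⟨f ≫ x, by simp⟩
  exists_eq := by
    rintro a b f x ⟨u, hu⟩
    obtain ⟨g, rfl⟩ := hh (hG.isFinitelyPresentable a) (hG.isFinitelyPresentable b) f u x hu
    exact ⟨g ≫ h, ⟨g, rfl⟩, by simpa using hu⟩

include hG in
lemma IsPureSub.isPure {K L : C} {h : K ⟶ L} [Mono h] (hh : IsPureSub (elementImage G h)) :
    IsPure.{w} h := by
  intro M N hM hN f u v e
  obtain ⟨a, ⟨i⟩⟩ := hG.exists_iso M
  obtain ⟨b, ⟨j⟩⟩ := hG.exists_iso N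
  obtain ⟨_, ⟨g, rfl⟩, hg⟩ := hh.exists_eq (i.inv ≫ f ≫ j.hom) (j.inv ≫ v)
    ⟨i.inv ≫ u, by simp [e]⟩
  refine ⟨j.hom ≫ g, ?_⟩
  rw [← cancel_mono h, ← cancel_epi i.inv, e]
  simpa using hg

variable {L : C} {T : ∀ a, Set (G a ⟶ L)} (hT : IsPureSub T)

include hT

lemma IsPureSub.neg_mem {a : A} {x : G a ⟶ L} (hx : x ∈ T a) : -x ∈ T a := by
  simpa using hT.comp_mem (-𝟙 (G a)) hx

include hG

variable [HasFiniteBiproducts C] [IsLocallyFinitelyPresentable.{w} C]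

/-- A pure subfunctor is represented by a pure subobject. -/
lemma IsPureSub.exists_subobject :
    ∃ (X : C) (j : X ⟶ L), Mono j ∧ elementImage G j = T ∧
      ∀ (κ : Cardinal.{w}) [Fact κ.IsRegular], HasCardinalLT (Σ a, T a) κ →
        HasCardinalLT (Σ a b, G a ⟶ G b) κ → IsCardinalPresentable X κ := by
  let Q : ElementSystem G :=
    { sec a := T a
      res f x := ⟨f ≫ x.1, hT.comp_mem f x.2⟩
      res_id _ := by simp
      res_comp _ _ _ := by simp }
  have hQ : Q.IsFlat :=
    { nonempty := by
        obtain ⟨a⟩ := hG.nonempty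
        exact ⟨a, ⟨⟨0, hT.zero_mem a⟩⟩⟩
      exists_pair {a b} q r := by
        obtain ⟨c, inl, inr, fst, snd, h₁, h₂, h₃, h₄⟩ := hG.exists_biprod a b
        refine ⟨c, inl, inr, ⟨fst ≫ q.1 + snd ≫ r.1, hT.add_mem (hT.comp_mem _ q.2)
          (hT.comp_mem _ r.2)⟩, Subtype.ext ?_, Subtype.ext ?_⟩
        · simp [Q, reassoc_of% h₁, reassoc_of% h₂]
        · simp [Q, reassoc_of% h₃, reassoc_of% h₄]
      exists_coeq {a b} f g q h := by
        obtain ⟨c, e, he, hc⟩ := hG.exists_cokernel (f - g)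
        have h' : f ≫ q.1 = g ≫ q.1 := congr_arg Subtype.val h
        obtain ⟨y, hy⟩ := hc q.1 (by simp [h'])
        -- `q` factors through the cokernel `e` as `e ≫ y`; purity replaces `y` by an element of
        -- `T`.
        obtain ⟨z, hz, hz'⟩ := hT.exists_eq e y (by rw [hy]; exact q.2)
        refine ⟨c, e, ⟨z, hz⟩, by simpa [sub_eq_zero] using he, Subtype.ext ?_⟩
        exact hz'.trans hy }
  obtain ⟨X, ι, hι, nat, hX⟩ := hQ.exists_representation hG
  let ε a := (Equiv.ofBijective (ι a) (hι a))
  obtain ⟨j, hj⟩ := hG.exists_hom (X := X) (Y := L) (fun a x ↦ ((ε a).symm x).1) (fun a b f x ↦ by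
    obtain ⟨q, rfl⟩ := (ε b).surjective x
    have : f ≫ ε b q = ε a (Q.res f q) := (nat a b f q).symm
    rw [this, Equiv.symm_apply_apply, Equiv.symm_apply_apply])
  refine ⟨X, j, hG.mono_of_injective j fun a x y h ↦ ?_, ?_, hX⟩
  · rw [hj, hj] at h
    exact (ε a).symm.injective (Subtype.ext h)
  · ext a x
    simp only [mem_elementImage, hj]
    exact ⟨by rintro ⟨y, rfl⟩; exact ((ε a).symm y).2, fun hx ↦ ⟨ε a ⟨x, hx⟩, by simp⟩⟩

/-- The quotient by a pure subfunctor is representable. -/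
lemma IsPureSub.exists_quotient :
    ∃ (S : C) (c : L ⟶ S), (∀ a (s : G a ⟶ S), ∃ x, x ≫ c = s) ∧
      ∀ a (x : G a ⟶ L), x ≫ c = 0 ↔ x ∈ T a := by
  let T' (a : A) : AddSubgroup (G a ⟶ L) :=
    { carrier := T a
      zero_mem' := hT.zero_mem a
      add_mem' := hT.add_mem
      neg_mem' := hT.neg_mem }
  have hT' (a : A) (x y : G a ⟶ L) : (x : _ ⧸ T' a) = y ↔ x - y ∈ T a := by
    rw [← sub_eq_zero, ← QuotientAddGroup.mk_sub, QuotientAddGroup.eq_zero_iff]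
    rfl
  let Q : ElementSystem G :=
    { sec a := (G a ⟶ L) ⧸ T' a
      res {a b} f := QuotientAddGroup.map (T' b) (T' a) (Preadditive.leftComp L f)
        (fun x hx ↦ hT.comp_mem f hx)
      res_id := by rintro a ⟨x⟩; exact congr_arg _ (Category.id_comp x)
      res_comp := by rintro a b c f g ⟨x⟩; exact congr_arg _ (Category.assoc f g x) }
  have hQ : Q.IsFlat :=
    { nonempty := by
        obtain ⟨a⟩ := hG.nonempty
        exact ⟨a, ⟨(0 : G a ⟶ L)⟩⟩
      exists_pair {a b} := by
        rintro ⟨q⟩ ⟨r⟩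
        obtain ⟨c, inl, inr, fst, snd, h₁, h₂, h₃, h₄⟩ := hG.exists_biprod a b
        refine ⟨c, inl, inr, QuotientAddGroup.mk (fst ≫ q + snd ≫ r), ?_, ?_⟩
        · refine congr_arg (QuotientAddGroup.mk (s := T' a)) ?_
          change inl ≫ (fst ≫ q + snd ≫ r) = q
          simp [reassoc_of% h₁, reassoc_of% h₂]
        · refine congr_arg (QuotientAddGroup.mk (s := T' b)) ?_
          change inr ≫ (fst ≫ q + snd ≫ r) = r
          simp [reassoc_of% h₃, reassoc_of% h₄]
      exists_coeq {a b} f g := by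
        rintro ⟨q⟩ h
        obtain ⟨c, e, he, hc⟩ := hG.exists_cokernel (f - g)
        replace h : f ≫ q - g ≫ q ∈ T a := (hT' _ _ _).1 h
        -- Purity corrects `q` by some `y ∈ T`, so that `q - y` is killed by `f - g` itself and not
        -- only modulo `T`.
        obtain ⟨y, hy, hy'⟩ := hT.exists_eq (f - g) q (by simpa using h)
        obtain ⟨z, hz⟩ := hc (q - y) (by rw [Preadditive.comp_sub, hy', sub_self])
        refine ⟨c, e, QuotientAddGroup.mk z, by simpa [sub_eq_zero] using he, (hT' _ _ _).2 ?_⟩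
        change e ≫ z - q ∈ _
        rw [hz]
        simpa using hT.neg_mem hy }
  obtain ⟨S, ι, hι, nat, -⟩ := hQ.exists_representation hG
  obtain ⟨c, hc⟩ := hG.exists_hom (X := L) (Y := S) (fun a x ↦ ι a (QuotientAddGroup.mk x))
    (fun a b f x ↦ by rw [← nat]; rfl)
  refine ⟨S, c, fun a s ↦ ?_, fun a x ↦ ?_⟩
  · obtain ⟨⟨x⟩, rfl⟩ := (hι a).surjective s
    exact ⟨x, hc _ _⟩
  · rw [← (zero_comp : (0 : G a ⟶ L) ≫ c = 0), hc, hc, (hι a).injective.eq_iff, hT', sub_zero]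

end

/-! ### Pure exact sequences, pushouts and the generating set -/

section

variable {C : Type u} [Category.{w} C] [Preadditive C]

/-- The sequence `K ⟶ L ⟶ S` induces exact sequences with surjective last map on
morphisms from the members of the family `G`. -/
structure IsPureExact {A : Type w} (G : A → C) {K L S : C} (h : K ⟶ L) (c : L ⟶ S) : Prop where
  exists_lift {a : A} (s : G a ⟶ S) : ∃ x, x ≫ c = s
  comp_eq_zero_iff {a : A} (x : G a ⟶ L) : x ≫ c = 0 ↔ ∃ y, y ≫ h = x

variable [HasFiniteBiproducts C] [IsLocallyFinitelyPresentable.{w} C]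
  {A : Type w} {G : A → C} (hG : IsFPFamily G)
  {K L S : C} {h : K ⟶ L} {c : L ⟶ S}

include hG

omit [HasFiniteBiproducts C] in
lemma isPureSub_ker (hc : ∀ a (s : G a ⟶ S), ∃ x, x ≫ c = s) :
    IsPureSub (fun a ↦ {x : G a ⟶ L | x ≫ c = 0}) where
  zero_mem a := by simp
  add_mem {a x y} hx hy := by
    simp only [Set.mem_ofPred_eq] at hx hy ⊢
    simp [hx, hy]
  comp_mem {a b} f x hx := by
    simp only [Set.mem_ofPred_eq] at hx ⊢
    simp [hx]
  exists_eq {a b} f x hx := by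
    simp only [Set.mem_ofPred_eq, Category.assoc] at hx
    obtain ⟨d, e, he, hd⟩ := hG.exists_cokernel f
    obtain ⟨s, hs⟩ := hd _ hx
    obtain ⟨z, rfl⟩ := hc d s
    -- Subtracting `e ≫ z` moves `x` into the kernel without changing `f ≫ x`, as `f ≫ e = 0`.
    exact ⟨x - e ≫ z, by simp [hs], by simp [reassoc_of% he]⟩

omit [Preadditive C] [HasFiniteBiproducts C] in
lemma epi_of_exists_lift (hc : ∀ a (s : G a ⟶ S), ∃ x, x ≫ c = s) : Epi c where
  left_cancellation f g e := hG.hom_ext fun a s ↦ by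
    obtain ⟨x, rfl⟩ := hc a s
    simp [e]

omit [HasFiniteBiproducts C] in
lemma exists_desc (hc : ∀ a (s : G a ⟶ S), ∃ x, x ≫ c = s) {Z : C} (z : L ⟶ Z)
    (hz : ∀ a (x : G a ⟶ L), x ≫ c = 0 → x ≫ z = 0) : ∃ d : S ⟶ Z, c ≫ d = z := by
  choose y hy using hc
  have key {a : A} (x x' : G a ⟶ L) (e : x ≫ c = x' ≫ c) : x ≫ z = x' ≫ z := by
    rw [← sub_eq_zero, ← Preadditive.sub_comp]
    exact hz _ _ (by simp [e])
  obtain ⟨d, hd⟩ := hG.exists_hom (X := S) (Y := Z) (fun a s ↦ y a s ≫ z) (fun a b f s ↦ by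
    rw [← Category.assoc]
    exact key _ _ (by simp [hy]))
  exact ⟨d, hG.hom_ext fun a x ↦ by rw [← Category.assoc, hd, key _ _ (hy _ _)]⟩

omit [HasFiniteBiproducts C] in
lemma IsPureExact.comp_eq_zero (H : IsPureExact G h c) : h ≫ c = 0 :=
  hG.hom_ext fun a x ↦ by
    rw [comp_zero, ← Category.assoc, H.comp_eq_zero_iff]
    exact ⟨x, rfl⟩

omit [HasFiniteBiproducts C] in
lemma IsPureExact.isPure [Mono h] (H : IsPureExact G h c) : IsPure.{w} h := by
  refine IsPureSub.isPure hG ?_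
  convert! isPureSub_ker hG (c := c) fun _ s ↦ H.exists_lift s using 2 with a
  ext x
  simp [H.comp_eq_zero_iff]

lemma IsPure.exists_isPureExact (hh : IsPure.{w} h) :
    ∃ (S : C) (c : L ⟶ S), IsPureExact G h c := by
  obtain ⟨S, c, h₁, h₂⟩ := (hh.isPureSub hG).exists_quotient hG
  exact ⟨S, c, h₁ _, h₂ _⟩

/-- The pure map `(-k, h)` has a quotient `S` with surjectivity on elements. The pushout `L'` maps
to `S`, so it suffices that `K' ⟶ S` is pure. There, a test map `N ⟶ S` lifts to `K' ⊞ L`, and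
purity of `h` corrects its first component. -/
lemma IsPure.of_isPushout {K' L' : C} {k : K ⟶ K'} {h' : K' ⟶ L'} {k' : L ⟶ L'}
    (sq : IsPushout k h h' k') (hh : IsPure.{w} h) : IsPure.{w} h' := by
  have : HasBinaryBiproducts C := hasBinaryBiproducts_of_finite_biproducts C
  have hm : IsPure.{w} (biprod.lift (-k) h) := .of_comp (h' := biprod.snd) (by simpa using hh)
  obtain ⟨S, c, H⟩ := hm.exists_isPureExact hG
  have hc := H.comp_eq_zero hG
  rw [biprod.lift_eq, Preadditive.add_comp] at hc
  obtain ⟨d, hd, -⟩ : ∃ d : L' ⟶ S, h' ≫ d = biprod.inl ≫ c ∧ k' ≫ d = biprod.inr ≫ c :=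
    ⟨sq.desc (biprod.inl ≫ c) (biprod.inr ≫ c)
      (by simpa [neg_add_eq_zero] using hc), by simp, by simp⟩
  refine IsPure.of_comp (h' := d) ?_
  rw [hd]
  intro M N hM hN f u v e
  obtain ⟨a, ⟨i⟩⟩ := hG.exists_iso M
  obtain ⟨b, ⟨j⟩⟩ := hG.exists_iso N
  obtain ⟨v', hv'⟩ := H.exists_lift (j.inv ≫ v)
  obtain ⟨y, hy⟩ := (H.comp_eq_zero_iff (i.inv ≫ (u ≫ biprod.inl - f ≫ j.hom ≫ v'))).1
    (by simp [e, hv'])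
  have h₁ := congr_arg (· ≫ biprod.fst) hy
  have h₂ := congr_arg (· ≫ biprod.snd) hy
  simp only [Category.assoc, biprod.lift_fst, biprod.lift_snd, Preadditive.sub_comp,
    Preadditive.comp_sub, biprod.inl_fst, biprod.inl_snd, comp_zero, zero_sub,
    Category.comp_id, Preadditive.comp_neg] at h₁ h₂
  obtain ⟨g, hg⟩ := hh (hG.isFinitelyPresentable a) hN (i.inv ≫ f) y
    (-(j.hom ≫ v' ≫ biprod.snd)) (by simp [h₂])
  refine ⟨j.hom ≫ v' ≫ biprod.fst - g ≫ k, ?_⟩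
  rw [← cancel_epi i.inv, Preadditive.comp_sub, Preadditive.comp_sub,
    ← Category.assoc i.inv f (g ≫ k), ← Category.assoc (i.inv ≫ f) g, hg, sub_eq_iff_eq_add,
    ← sub_eq_iff_eq_add', ← neg_sub, ← h₁, neg_neg]

omit hG

variable (C) in
lemma pureMonomorphisms_isCofibrantlyClosed :
    MorphismProperty.IsCofibrantlyClosed.{w} (MorphismProperty.pureMonomorphisms.{w} C) := by
  obtain ⟨A, G, hG⟩ := exists_isFPFamily (C := C)
  have mk {K L : C} {h : K ⟶ L} (hh : IsPure.{w} h) :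
    MorphismProperty.pureMonomorphisms.{w} C h := ⟨hh, hh.mono⟩
  have hpush : (MorphismProperty.pureMonomorphisms.{w} C).IsStableUnderCobaseChange :=
    ⟨fun sq hf ↦ mk (hf.1.of_isPushout hG sq)⟩
  have : (MorphismProperty.pureMonomorphisms.{w} C).IsMultiplicative :=
    { id_mem X := mk (.of_isIso (h := 𝟙 X))
      comp_mem _ _ hf hg := mk (hf.1.comp hg.1) }
  have : MorphismProperty.IsStableUnderFilteredColimits.{w, w}
      (MorphismProperty.pureMonomorphisms.{w} C) :=
    { isStableUnderColimitsOfShape J _ _ :=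
        ⟨fun _ _ _ _ hc hc' f hf φ hφ ↦ mk (.of_isColimit hc hc' f (fun j ↦ (hf j).1) φ hφ)⟩ }
  exact ⟨hpush, inferInstance, ⟨fun r hg ↦ mk (.of_retract r hg.1)⟩⟩

include hG

/-- The map `K ⊞ P ⟶ L` is surjective on elements, and the elements it kills come from `N`; hence
`L` has the universal property of the pushout. -/
lemma IsPureExact.exists_isPushout [Mono h] (H : IsPureExact G h c) {N P : C} {k : N ⟶ P}
    {π : P ⟶ S} (H' : IsPureExact G k π) (l : P ⟶ L) (hl : l ≫ c = π) :
    ∃ t : N ⟶ K, IsPushout t k h l := by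
  have : HasBinaryBiproducts C := hasBinaryBiproducts_of_finite_biproducts C
  obtain ⟨t, ht⟩ := hG.exists_lift (k ≫ l) h (fun a x ↦ (H.comp_eq_zero_iff _).1 (by
    simp [hl, H'.comp_eq_zero hG]))
  have hD : ∀ a (x : G a ⟶ L), ∃ z, z ≫ biprod.desc h l = x := fun a x ↦ by
    obtain ⟨y, hy⟩ := H'.exists_lift (x ≫ c)
    obtain ⟨z, hz⟩ := (H.comp_eq_zero_iff (x - y ≫ l)).1 (by simp [hl, hy])
    exact ⟨biprod.lift z y, by simp [hz]⟩
  have := epi_of_exists_lift hG hD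
  have hdesc (s : PushoutCocone t k) :
      ∃ d : L ⟶ s.pt, biprod.desc h l ≫ d = biprod.desc s.inl s.inr := by
    refine exists_desc hG hD _ fun a x hx ↦ ?_
    have hx' : x = biprod.lift (x ≫ biprod.fst) (x ≫ biprod.snd) := by ext <;> simp
    generalize x ≫ biprod.fst = q, x ≫ biprod.snd = p at hx'
    subst hx'
    simp only [biprod.lift_desc] at hx ⊢
    obtain ⟨y, rfl⟩ := (H'.comp_eq_zero_iff p).1 (by
      simpa [hl, H.comp_eq_zero hG] using congr_arg (· ≫ c) hx)
    have : q = - (y ≫ t) := by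
      rw [← cancel_mono h, eq_neg_iff_add_eq_zero.2 hx]
      simp [ht]
    simp [this, s.condition]
  choose d hd using hdesc
  have hd₁ (s) : h ≫ d s = s.inl := by simpa using biprod.inl ≫= hd s
  have hd₂ (s) : l ≫ d s = s.inr := by simpa using biprod.inr ≫= hd s
  refine ⟨t, ⟨⟨ht⟩, ⟨PushoutCocone.IsColimit.mk _ d hd₁ hd₂ fun s m h₁ h₂ ↦ ?_⟩⟩⟩
  rw [← cancel_epi (biprod.desc h l)]
  ext <;> simp [h₁, h₂, hd₁, hd₂]

/-- For every object `S` there is a pure exact sequence whose middle term is projective with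
respect to pure epimorphisms. -/
lemma exists_isPureExact_projective (S : C) :
    ∃ (N P : C) (k : N ⟶ P) (π : P ⟶ S), Mono k ∧ IsPureExact G k π ∧
      ∀ {L : C} (c : L ⟶ S), (∀ a (s : G a ⟶ S), ∃ x, x ≫ c = s) → ∃ l : P ⟶ L, l ≫ c = π := by
  let ι := Σ a, (G a ⟶ S)
  let P := ∐ fun i : ι ↦ G i.1
  let π : P ⟶ S := Limits.Sigma.desc fun i ↦ i.2
  have hπ (a) (s : G a ⟶ S) : ∃ x, x ≫ π = s :=
    ⟨Limits.Sigma.ι (fun i : ι ↦ G i.1) ⟨a, s⟩, by simp [π]⟩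
  obtain ⟨N, k, hk, hk', -⟩ := (isPureSub_ker hG hπ).exists_subobject hG
  refine ⟨N, P, k, π, hk, ⟨hπ _, fun {a} x ↦ ?_⟩, fun {L} c hc ↦ ?_⟩
  · have := Set.ext_iff.1 (congr_fun hk' a) x
    simpa using this.symm
  · choose y hy using hc
    exact ⟨Limits.Sigma.desc fun i ↦ y i.1 i.2, Limits.Sigma.hom_ext _ _ fun i ↦ by simp [hy, π]⟩

variable (G) in
lemma exists_small_generating (κ : Cardinal.{w}) [Fact κ.IsRegular] :
    ∃ X : MorphismProperty C, MorphismProperty.IsSmall.{w} X ∧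
      X ≤ MorphismProperty.pureMonomorphisms.{w} C ∧
      ∀ {K L S : C} (h : K ⟶ L) (c : L ⟶ S) [Mono h] [IsCardinalPresentable S κ],
        IsPureExact G h c → X.pushouts h := by
  have : Fact Cardinal.aleph0.{w}.IsRegular := Cardinal.fact_isRegular_aleph0
  have := IsCardinalLocallyPresentable.of_le C (κ := Cardinal.aleph0.{w})
    (Cardinal.IsRegular.aleph0_le (c := κ) Fact.out)
  obtain ⟨Q, _, hQ, hQ'⟩ := ObjectProperty.EssentiallySmall.exists_small_le.{w}
    (isCardinalPresentable C κ)
  choose N P k π hk H hP using fun S ↦ exists_isPureExact_projective hG S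
  refine ⟨MorphismProperty.ofHoms (fun S : Subtype Q ↦ k S.1), inferInstance, ?_, ?_⟩
  · rintro _ _ _ ⟨S⟩
    exact ⟨(H S.1).isPure hG, inferInstance⟩
  · intro K L S h c _ hS E
    obtain ⟨S', hS', ⟨e⟩⟩ := hQ' S hS
    have E' : IsPureExact G h (c ≫ e.hom) :=
      { exists_lift s := by
          obtain ⟨x, hx⟩ := E.exists_lift (s ≫ e.inv)
          exact ⟨x, by simp [reassoc_of% hx]⟩
        comp_eq_zero_iff x := by
          rw [← E.comp_eq_zero_iff, ← Category.assoc, Preadditive.IsIso.comp_right_eq_zero] }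
    obtain ⟨l, hl⟩ := hP S' (c ≫ e.hom) fun _ s ↦ E'.exists_lift s
    obtain ⟨t, ht⟩ := E'.exists_isPushout hG (H S') l hl
    exact MorphismProperty.pushouts_mk _ ht (MorphismProperty.ofHoms.mk (i := (⟨S', hS'⟩ : Subtype Q)))

end

/-! ### Löwenheim–Skolem for pure subfunctors -/

lemma exists_closed_set_hasCardinalLT {E : Type*} {R : Type*} (op : E → E → E) (act : R → E → E)
    (κ : Cardinal.{w}) [Fact κ.IsRegular] (hN : HasCardinalLT ℕ κ) (hR : HasCardinalLT R κ)
    (x : E) :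
    ∃ t : Set E, x ∈ t ∧ (∀ y ∈ t, ∀ z ∈ t, op y z ∈ t) ∧ (∀ r, ∀ y ∈ t, act r y ∈ t) ∧
      HasCardinalLT t κ := by
  have hκ : Cardinal.aleph0 ≤ κ := Cardinal.IsRegular.aleph0_le Fact.out
  -- Close up countably often; regularity of `κ` and `ℕ` being smaller than `κ` keep the union
  -- small.
  let s (n : ℕ) : Set E := Nat.rec (motive := fun _ ↦ Set E) {x}
    (fun _ (t : Set E) ↦ (t ∪ Set.range fun p : t × t ↦ op p.1 p.2) ∪
      Set.range fun p : R × t ↦ act p.1 p.2) n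
  have hs (n : ℕ) : s (n + 1) = (s n ∪ Set.range fun p : ↥(s n) × ↥(s n) ↦ op p.1 p.2) ∪
      Set.range fun p : R × ↥(s n) ↦ act p.1 p.2 := rfl
  have mono : Monotone s := monotone_nat_of_le_succ fun n ↦ by
    rw [hs, Set.union_assoc]
    exact Set.subset_union_left
  refine ⟨⋃ n, s n, Set.mem_iUnion.2 ⟨0, rfl⟩, fun y hy z hz ↦ ?_, fun r y hy ↦ ?_,
    hasCardinalLT_iUnion _ hN fun n ↦ ?_⟩
  · obtain ⟨n, hn⟩ := Set.mem_iUnion.1 hy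
    obtain ⟨m, hm⟩ := Set.mem_iUnion.1 hz
    refine Set.mem_iUnion.2 ⟨max n m + 1, Or.inl (Or.inr ⟨⟨⟨y, ?_⟩, ⟨z, ?_⟩⟩, rfl⟩)⟩
    · exact mono (le_max_left n m) hn
    · exact mono (le_max_right n m) hm
  · obtain ⟨n, hn⟩ := Set.mem_iUnion.1 hy
    exact Set.mem_iUnion.2 ⟨n + 1, Or.inr ⟨⟨r, ⟨y, hn⟩⟩, rfl⟩⟩
  · induction n with
    | zero => exact hasCardinalLT_of_finite ({x} : Set E) κ hκ
    | succ n hn =>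
      rw [hs]
      exact hasCardinalLT_union hκ (hasCardinalLT_union hκ hn
        ((hasCardinalLT_prod hκ hn hn).of_surjective _ Set.rangeFactorization_surjective))
        ((hasCardinalLT_prod hκ hR hn).of_surjective _ Set.rangeFactorization_surjective)

section

variable {C : Type u} [Category.{w} C] [Preadditive C] {A : Type w} {G : A → C}

open Classical in
/-- Every element is contained in a small pure subfunctor. -/
lemma exists_isPureSub_hasCardinalLT {S : C} {a₀ : A} (s : G a₀ ⟶ S)
    (κ : Cardinal.{w}) [Fact κ.IsRegular] (hN : HasCardinalLT ℕ κ)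
    (hR : HasCardinalLT (Σ a b, G a ⟶ G b) κ) :
    ∃ T : ∀ a, Set (G a ⟶ S), IsPureSub T ∧ s ∈ T a₀ ∧ HasCardinalLT (Σ a, T a) κ := by
  have hκ : Cardinal.aleph0 ≤ κ := Cardinal.IsRegular.aleph0_le Fact.out
  -- Addition on the set of all elements, with default `x` when the domains differ.
  let op (x y : Σ a, G a ⟶ S) : Σ a, G a ⟶ S :=
    if h : y.1 = x.1 then ⟨x.1, x.2 + eqToHom (by rw [h]) ≫ y.2⟩ else x
  let R := Σ a b, G a ⟶ G b
  -- The left copy restricts along `f`; the right copy is a Skolem function choosing a solution `y`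
  -- of `f ≫ y = x` when one exists.
  let act : R ⊕ R → (Σ a, G a ⟶ S) → (Σ a, G a ⟶ S)
    | .inl f, x => if h : x.1 = f.2.1 then ⟨f.1, f.2.2 ≫ eqToHom (by rw [h]) ≫ x.2⟩ else x
    | .inr f, x => if h : ∃ y, x = ⟨f.1, f.2.2 ≫ y⟩ then ⟨f.2.1, h.choose⟩ else x
  obtain ⟨t, hs, hop, hact, ht⟩ := exists_closed_set_hasCardinalLT op act κ hN
    ((hasCardinalLT_sum_iff _ _ _ hκ).2 ⟨hR, hR⟩) ⟨a₀, s⟩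
  let T (a : A) : Set (G a ⟶ S) := {x | ⟨a, x⟩ ∈ t}
  have comp_mem {a b : A} (f : G a ⟶ G b) {x : G b ⟶ S} (hx : x ∈ T b) : f ≫ x ∈ T a := by
    have := hact (.inl ⟨a, b, f⟩) ⟨b, x⟩ hx
    simpa [act] using! this
  have zero_mem (a : A) : 0 ∈ T a := by simpa using comp_mem (0 : G a ⟶ G a₀) (x := s) hs
  refine ⟨T, ⟨zero_mem, fun {a x y} hx hy ↦ ?_, comp_mem, fun {a b} f x hx ↦ ?_⟩, hs,
    ht.of_injective (fun x ↦ ⟨⟨x.1, x.2.1⟩, x.2.2⟩) ?_⟩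
  · have := hop ⟨a, x⟩ hx ⟨a, y⟩ hy
    simpa [op] using! this
  · have h : ∃ y, (⟨a, f ≫ x⟩ : Σ a, G a ⟶ S) = ⟨a, f ≫ y⟩ := ⟨x, rfl⟩
    have := hact (.inr ⟨a, b, f⟩) ⟨a, f ≫ x⟩ hx
    simp only [act] at this
    rw [dif_pos h] at this
    exact ⟨h.choose, this, by simpa using h.choose_spec.symm⟩
  · rintro ⟨a, x, hx⟩ ⟨b, y, hy⟩ e
    simp only [Subtype.mk.injEq, Sigma.mk.injEq] at e
    obtain ⟨rfl, e⟩ := e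
    obtain rfl := eq_of_heq e
    rfl

variable [HasFiniteBiproducts C] [IsLocallyFinitelyPresentable.{w} C] (hG : IsFPFamily G)

include hG in
/-- A proper pure subfunctor is contained in a strictly larger one such that the quotient of the
corresponding subobjects is small. -/
lemma IsPureSub.exists_lt {L : C} {T : ∀ a, Set (G a ⟶ L)} (hT : IsPureSub T) (hT' : T ≠ ⊤)
    (κ : Cardinal.{w}) [Fact κ.IsRegular] (hN : HasCardinalLT ℕ κ)
    (hR : HasCardinalLT (Σ a b, G a ⟶ G b) κ) :
    ∃ T' : ∀ a, Set (G a ⟶ L), IsPureSub T' ∧ T < T' ∧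
      ∀ {X X' : C} (j : X ⟶ L) (j' : X' ⟶ L) (k : X ⟶ X') [Mono j'], k ≫ j' = j →
        elementImage G j = T → elementImage G j' = T' →
        ∃ (S : C) (c : X' ⟶ S), IsCardinalPresentable S κ ∧ IsPureExact G k c := by
  obtain ⟨S₀, c, hc, hc'⟩ := hT.exists_quotient hG
  obtain ⟨a₀, x₀, hx₀⟩ : ∃ a, ∃ x : G a ⟶ L, x ∉ T a := by
    by_contra! H
    exact hT' (funext fun a ↦ Set.eq_univ_of_forall (H a))
  -- `U` is a small pure subfunctor of the quotient by `T` containing the nonzero class of `x₀`. Its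
  -- preimage is the larger subfunctor, and the new quotient is `U`.
  obtain ⟨U, hU, hx₀', hU'⟩ := exists_isPureSub_hasCardinalLT (x₀ ≫ c) κ hN hR
  obtain ⟨S, i, _, hi, hS⟩ := hU.exists_subobject hG
  have hi' {a} (s : G a ⟶ S₀) : s ∈ U a ↔ ∃ y, y ≫ i = s := by rw [← hi, mem_elementImage]
  have hle (a) : T a ⊆ {x | x ≫ c ∈ U a} := fun x hx ↦ by
    simpa only [Set.mem_ofPred_eq, (hc' a x).2 hx] using hU.zero_mem a
  refine ⟨fun a ↦ {x | x ≫ c ∈ U a}, ⟨fun a ↦ ?_, fun hx hy ↦ ?_, fun f x hx ↦ ?_,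
    fun {a b} f x hx ↦ ?_⟩, lt_of_le_not_ge hle fun H ↦ hx₀ (H a₀ hx₀'), ?_⟩
  · simpa using hU.zero_mem a
  · simpa using hU.add_mem hx hy
  · simpa using hU.comp_mem f hx
  · obtain ⟨y, hy, hy'⟩ := hU.exists_eq f (x ≫ c) (by simpa using hx)
    obtain ⟨z, rfl⟩ := hc b y
    -- `z` solves the problem only modulo `T`; purity of `T` supplies the correction `t`.
    obtain ⟨t, ht, ht'⟩ := hT.exists_eq f (x - z) ((hc' _ _).1 (by simp [hy']))
    refine ⟨z + t, ?_, by simp [ht']⟩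
    simp only [Set.mem_ofPred_eq, Preadditive.add_comp, (hc' _ _).2 ht, add_zero]
    exact hy
  · intro X X' j j' k _ hk hj hj'
    have hj₁ {a} (x : G a ⟶ L) : x ∈ T a ↔ ∃ y, y ≫ j = x := by rw [← hj, mem_elementImage]
    have hj₂ {a} (x : G a ⟶ L) : x ≫ c ∈ U a ↔ ∃ y, y ≫ j' = x := by
      rw [← mem_elementImage, hj']
      rfl
    obtain ⟨q, hq⟩ := hG.exists_lift (j' ≫ c) i fun a x ↦
      (hi' _).1 (by simpa using (hj₂ (x ≫ j')).2 ⟨x, rfl⟩)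
    refine ⟨S, q, hS κ hU' hR, fun {a} s ↦ ?_, fun {a} x ↦ ?_⟩
    · obtain ⟨x, hx⟩ := hc a (s ≫ i)
      obtain ⟨y, rfl⟩ := (hj₂ x).1 (by rw [hx, hi']; exact ⟨s, rfl⟩)
      exact ⟨y, by rw [← cancel_mono i, Category.assoc, hq, ← hx, Category.assoc]⟩
    · rw [← cancel_mono i, zero_comp, Category.assoc, hq, ← Category.assoc, hc', hj₁]
      simp [← hk, ← cancel_mono j']

end

/-! ### The transfinite filtration of a pure monomorphism -/

variable {C : Type u} [Category.{w} C] [Preadditive C] {A : Type w} {G : A → C}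

lemma isPureSub_top (L : C) : IsPureSub (G := G) (L := L) ⊤ where
  zero_mem _ := trivial
  add_mem _ _ := trivial
  comp_mem _ _ _ := trivial
  exists_eq _ x _ := ⟨x, trivial, rfl⟩

omit [Preadditive C] in
lemma mem_iSup_apply {L : C} {ι : Type*} {T : ι → ∀ a, Set (G a ⟶ L)} {a : A} {x : G a ⟶ L} :
    x ∈ (⨆ i, T i) a ↔ ∃ i, x ∈ T i a := by
  simp

lemma isPureSub_iSup {L : C} {ι : Type*} [Preorder ι] [IsDirectedOrder ι] [Nonempty ι]
    {T : ι → ∀ a, Set (G a ⟶ L)} (hT : Monotone T) (hT' : ∀ i, IsPureSub (T i)) :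
    IsPureSub (⨆ i, T i) := by
  constructor
  · intro a
    exact mem_iSup_apply.2 ⟨Classical.arbitrary ι, (hT' _).zero_mem a⟩
  · intro a x y hx hy
    obtain ⟨i, hi⟩ := mem_iSup_apply.1 hx
    obtain ⟨j, hj⟩ := mem_iSup_apply.1 hy
    obtain ⟨k, hik, hjk⟩ := exists_ge_ge i j
    exact mem_iSup_apply.2 ⟨k, (hT' k).add_mem (hT hik a hi) (hT hjk a hj)⟩
  · intro a b f x hx
    obtain ⟨i, hi⟩ := mem_iSup_apply.1 hx
    exact mem_iSup_apply.2 ⟨i, (hT' i).comp_mem f hi⟩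
  · intro a b f x hx
    obtain ⟨i, hi⟩ := mem_iSup_apply.1 hx
    obtain ⟨y, hy, hy'⟩ := (hT' i).exists_eq f x hi
    exact ⟨y, mem_iSup_apply.2 ⟨i, hy⟩, hy'⟩

variable [HasFiniteBiproducts C] [IsLocallyFinitelyPresentable.{w} C]

/-- An increasing family of pure subfunctors is represented by a diagram of subobjects. -/
lemma exists_diagram_of_isPureSub (hG : IsFPFamily G) {L : C} {J : Type*} [Preorder J]
    {T : J → ∀ a, Set (G a ⟶ L)} (hT : Monotone T) (hT' : ∀ j, IsPureSub (T j)) :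
    ∃ (F : J ⥤ C) (ι : ∀ j, F.obj j ⟶ L), (∀ j, Mono (ι j)) ∧
      (∀ j, elementImage G (ι j) = T j) ∧ ∀ i j (f : i ⟶ j), F.map f ≫ ι j = ι i := by
  choose X ι hι hι' _ using fun j ↦ (hT' j).exists_subobject hG
  have hl {i j : J} (f : i ⟶ j) : ∃ k : X i ⟶ X j, k ≫ ι j = ι i :=
    hG.exists_lift _ _ fun a x ↦ by
      rw [← mem_elementImage, hι']
      refine hT (leOfHom f) a ?_
      rw [← hι', mem_elementImage]
      exact ⟨x, rfl⟩
  choose l hl using @hl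
  exact ⟨{ obj := X
           map := l
           map_id j := by rw [← cancel_mono (ι j), hl, Category.id_comp]
           map_comp {i j k} f g := by
             rw [← cancel_mono (ι k), hl, Category.assoc, hl, hl] }, ι, hι, hι', fun _ _ ↦ hl⟩

open Classical in
lemma IsPure.exists_transfiniteCompositionOfShape (hG : IsFPFamily G) (κ : Cardinal.{w})
    [Fact κ.IsRegular] (hN : HasCardinalLT ℕ κ) (hR : HasCardinalLT (Σ a b, G a ⟶ G b) κ)
    {W : MorphismProperty C}
    (hW : ∀ {K L S : C} (h : K ⟶ L) (c : L ⟶ S) [Mono h] [IsCardinalPresentable S κ],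
      IsPureExact G h c → W h)
    {K L : C} {h : K ⟶ L} (hh : IsPure.{w} h) :
    ∃ (J : Type w) (_ : LinearOrder J) (_ : OrderBot J) (_ : SuccOrder J) (_ : WellFoundedLT J),
      Nonempty (W.TransfiniteCompositionOfShape J h) := by
  let I := ∀ a, Set (G a ⟶ L)
  choose E hE hE' hE'' using fun (T : {T : I // IsPureSub T ∧ T ≠ ⊤}) ↦
    T.2.1.exists_lt hG T.2.2 κ hN hR
  -- Extended by `⊤` to families that are not pure or not proper, so that `φ` is strictly increasing
  -- away from its fixed point `⊤`.
  let φ (T : I) : I := if hT : IsPureSub T ∧ T ≠ ⊤ then E ⟨T, hT⟩ else ⊤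
  have φ_of (T : I) (hT : IsPureSub T) (hT' : T ≠ ⊤) : φ T = E ⟨T, hT, hT'⟩ :=
    dif_pos ⟨hT, hT'⟩
  have φ_top : φ ⊤ = ⊤ := dif_neg (by simp)
  have lt_φ (T : I) (hT : T ≠ ⊤) : T < φ T := by
    by_cases hT' : IsPureSub T
    · rw [φ_of T hT' hT]
      exact hE' ⟨T, hT', hT⟩
    · have : φ T = ⊤ := dif_neg (by tauto)
      rw [this]
      exact hT.lt_top
  have le_φ (T : I) : T ≤ φ T := by
    by_cases hT : T = ⊤
    · rw [hT, φ_top]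
    · exact (lt_φ T hT).le
  have pure_φ (T : I) : IsPureSub (φ T) := by
    by_cases hT : IsPureSub T ∧ T ≠ ⊤
    · rw [φ_of T hT.1 hT.2]
      exact hE _
    · have : φ T = ⊤ := dif_neg hT
      rw [this]
      exact isPureSub_top L
  -- More stages than families: the iteration cannot be injective, so it reaches `⊤`.
  let μ := Order.succ (Cardinal.mk I)
  let J := μ.ord.ToType
  have : Nonempty J := by simp [J, μ]
  let : OrderBot J := WellFoundedLT.toOrderBot J
  let T₀ : I := elementImage G h
  obtain ⟨m, hm⟩ : ∃ m : J, transfiniteIterate φ m T₀ = ⊤ :=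
    top_mem_range_transfiniteIterate φ T₀ lt_φ φ_top fun hinj ↦
      (Order.lt_succ (Cardinal.mk I)).not_ge (by
        simpa [J, μ] using! Cardinal.mk_le_of_injective hinj)
  have mono := monotone_transfiniteIterate φ T₀ (J := J) le_φ
  have hpure (j : J) : IsPureSub (transfiniteIterate φ j T₀) := by
    induction j using SuccOrder.limitRecOn with
    | isMin j hj =>
      obtain rfl := hj.eq_bot
      rw [transfiniteIterate_bot]
      exact hh.isPureSub hG
    | succ j hj _ =>
      rw [transfiniteIterate_succ _ _ _ hj]
      exact pure_φ _
    | isSuccLimit j hj ih =>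
      rw [transfiniteIterate_limit _ _ _ hj]
      have := hj.nonempty_Iio.to_subtype
      exact isPureSub_iSup (fun x y hxy ↦ mono hxy) fun x ↦ ih x.1 x.2
  obtain ⟨F, ι, hι_mono, hι, hF⟩ := exists_diagram_of_isPureSub hG mono hpure
  have hF_mono : ∀ i j (f : i ⟶ j), Mono (F.map f) := fun i j f ↦ by
    have : Mono (F.map f ≫ ι j) := by rw [hF]; infer_instance
    exact mono_of_mono (F.map f) (ι j)
  have : F.IsWellOrderContinuous := ⟨fun l hl ↦ by
    have := hl.nonempty_Iio.to_subtype
    have : ∀ i, Mono (((Set.principalSegIio l).cocone F).ι.app i) := fun _ ↦ hF_mono _ _ _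
    refine hG.nonempty_isColimit _ fun a x ↦ ?_
    change G a ⟶ F.obj l at x
    have hx : x ≫ ι l ∈ elementImage G (ι l) a := ⟨x, rfl⟩
    rw [hι, transfiniteIterate_limit _ _ _ hl] at hx
    obtain ⟨i, hi⟩ := mem_iSup_apply.1 hx
    rw [← hι] at hi
    obtain ⟨y, hy⟩ := hi
    refine ⟨i, y, ?_⟩
    change y ≫ F.map _ = x
    rw [← cancel_mono (ι l), Category.assoc]
    exact (congr_arg (y ≫ ·) (hF _ _ _)).trans hy⟩
  obtain ⟨e, he⟩ : ∃ e : K ≅ F.obj ⊥, e.hom ≫ ι ⊥ = h := by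
    have := hh.mono
    have hbot {a} (x : G a ⟶ L) : (∃ y, y ≫ ι ⊥ = x) ↔ ∃ y, y ≫ h = x := by
      rw [← mem_elementImage, hι]
      simp [T₀]
    obtain ⟨p, hp⟩ := hG.exists_lift h (ι ⊥) fun a x ↦ (hbot _).2 ⟨x, rfl⟩
    obtain ⟨q, hq⟩ := hG.exists_lift (ι ⊥) h fun a x ↦ (hbot _).1 ⟨x, rfl⟩
    exact ⟨⟨p, q, by rw [← cancel_mono h, Category.assoc, hq, hp, Category.id_comp],
      by rw [← cancel_mono (ι ⊥), Category.assoc, hp, hq, Category.id_comp]⟩, hp⟩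
  have : IsIso (ι m) := by
    obtain ⟨p, hp⟩ := hG.exists_lift (𝟙 L) (ι m) fun a x ↦ by
      rw [← mem_elementImage, hι, hm]
      trivial
    exact ⟨p, by rw [← cancel_mono (ι m), Category.assoc, hp, Category.comp_id,
      Category.id_comp], hp⟩
  have step (j : J) (hj : ¬ IsMax j) : W (F.map (homOfLE (Order.le_succ j))) := by
    -- The chain may reach `⊤` before stage `m`; steps after that have zero quotient.
    by_cases hj' : transfiniteIterate φ j T₀ = ⊤
    · obtain ⟨Z, hZ⟩ : ∃ Z : C, IsZero Z :=
        have : HasZeroObject C := hasZeroObject_of_hasFiniteBiproducts C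
        HasZeroObject.zero
      have := isFinitelyPresentable_of_isZero hZ
      have : IsCardinalPresentable Z κ :=
        have : Fact Cardinal.aleph0.{w}.IsRegular := Cardinal.fact_isRegular_aleph0
        isCardinalPresentable_of_le (κ := Cardinal.aleph0.{w}) Z
          (Cardinal.IsRegular.aleph0_le Fact.out)
      refine hW _ (0 : _ ⟶ Z) ⟨fun _ ↦ ⟨0, hZ.eq_of_tgt _ _⟩, fun {a} x ↦
        ⟨fun _ ↦ ?_, fun _ ↦ comp_zero⟩⟩
      have hx : x ≫ ι (Order.succ j) ∈ elementImage G (ι j) a := by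
        rw [hι, hj']
        trivial
      obtain ⟨y, hy⟩ := hx
      refine ⟨y, ?_⟩
      rw [← cancel_mono (ι (Order.succ j)), Category.assoc, hF]
      exact hy
    · obtain ⟨S, c, hS, hc⟩ := hE'' ⟨_, hpure j, hj'⟩ (ι j) (ι (Order.succ j))
        (F.map (homOfLE (Order.le_succ j))) (hF _ _ _) (hι j) (by
          rw [hι, transfiniteIterate_succ _ _ _ hj, φ_of _ (hpure j) hj'])
      exact hW _ c hc
  exact ⟨Set.Iic m, inferInstance, inferInstance, inferInstance, inferInstance, ⟨{
    F := (Set.initialSegIic m).monotone.functor ⋙ F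
    isoBot := e.symm
    incl :=
      { app k := ι k.1
        naturality k k' f := (hF _ _ _).trans (Category.comp_id _).symm }
    isColimit := IsColimit.ofIsoColimit (colimitOfDiagramTerminal isTerminalTop _)
      (Cocone.ext (@asIso _ _ _ _ (ι m) this) fun k ↦ hF _ _ _)
    fac := he
    map_mem k hk := by
      have hk' := Set.not_isMax_coe _ hk
      have := step k.1 hk'
      rw [← W.arrow_mk_mem_toSet_iff] at this ⊢
      have eq : Arrow.mk ((Set.initialSegIic m).monotone.functor.map (homOfLE (Order.le_succ k))) =
          Arrow.mk (homOfLE (Order.le_succ k.1)) :=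
        Arrow.ext rfl (Set.Iic.coe_succ_of_not_isMax hk) rfl
      replace eq := congr_arg F.mapArrow.obj eq
      convert! this using 1 }⟩⟩

theorem isCofibrantlyGenerated_pureMonomorphisms (C : Type u) [Category.{w} C] [Preadditive C]
    [HasFiniteBiproducts C] [IsLocallyFinitelyPresentable.{w} C] :
    MorphismProperty.IsCofibrantlyGenerated.{w} (MorphismProperty.pureMonomorphisms.{w} C) := by
  obtain ⟨A, G, hG⟩ := exists_isFPFamily (C := C)
  -- `κ` must exceed the countable number of closure steps and the number of maps between members of
  -- `G`.
  obtain ⟨κ, hκ, hκ'⟩ := HasCardinalLT.exists_regular_cardinal.{w} (ℕ ⊕ Σ a b, G a ⟶ G b)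
  have : Fact κ.IsRegular := ⟨hκ⟩
  obtain ⟨hN, hR⟩ := (hasCardinalLT_sum_iff _ _ _ hκ.aleph0_le).1 hκ'
  obtain ⟨X, hX, hX', hX''⟩ := exists_small_generating G hG κ
  refine ⟨X, hX, le_antisymm
    (fun _ _ _ hf ↦ hf _ (pureMonomorphisms_isCofibrantlyClosed C) hX') fun K L h hh W hW hXW ↦ ?_⟩
  obtain ⟨J, _, _, _, _, ⟨hJ⟩⟩ := hh.1.exists_transfiniteCompositionOfShape hG κ hN hR hX''
  have := hW.pushout
  have := hW.transfiniteComposition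
  have hle : X.pushouts ≤ W := MorphismProperty.pushouts_le_iff.2 hXW
  exact W.transfiniteCompositionsOfShape_le J h ⟨hJ.ofLE hle⟩

/-! ### Module categories are locally finitely presentable -/

lemma ModuleCat.isFinitelyPresentable_of_self (R : Type w) [Ring R] :
    IsFinitelyPresentable.{w} (ModuleCat.of R R) := by
  rw [isFinitelyPresentable_iff_preservesFilteredColimits]
  -- Evaluation at `1` identifies maps out of `R` with the forgetful functor, which preserves
  -- filtered colimits.
  let e : coyoneda.obj (.op (ModuleCat.of R R)) ≅ forget (ModuleCat.{w} R) :=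
    NatIso.ofComponents (fun M ↦ ((ModuleCat.homEquiv (M := ModuleCat.of R R) (N := M)).trans
      (LinearMap.ringLmapEquivSelf R ℤ M).toEquiv).toIso) (fun f ↦ by ext; rfl)
  exact ⟨fun J _ _ ↦ preservesColimitsOfShape_of_natIso e.symm⟩

lemma ModuleCat.isStrongGenerator_self (R : Type w) [Ring R] :
    (ObjectProperty.singleton (ModuleCat.of R R)).IsStrongGenerator := by
  rw [ObjectProperty.isStrongGenerator_iff]
  have hf {M : ModuleCat.{w} R} (x : M) :
      (ModuleCat.ofHom (LinearMap.toSpanSingleton R M x)).hom 1 = x := by simp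
  refine ⟨fun X Y f g h ↦ ?_, fun X Y i _ h ↦ ?_⟩
  · ext x
    have := congr(($(h _ ⟨⟨⟩⟩ (ModuleCat.ofHom (LinearMap.toSpanSingleton R X x)))).hom 1)
    simpa using this
  · rw [ConcreteCategory.isIso_iff_bijective]
    refine ⟨(ModuleCat.mono_iff_injective i).1 inferInstance, fun y ↦ ?_⟩
    obtain ⟨p, hp⟩ := h _ ⟨⟨⟩⟩ (ModuleCat.ofHom (LinearMap.toSpanSingleton R Y y))
    exact ⟨p.hom 1, by simpa using congr(($hp).hom 1)⟩

instance ModuleCat.isLocallyFinitelyPresentable (R : Type w) [Ring R] :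
    IsLocallyFinitelyPresentable.{w} (ModuleCat.{w} R) := by
  have : Fact Cardinal.aleph0.{w}.IsRegular := Cardinal.fact_isRegular_aleph0
  refine (IsCardinalLocallyPresentable.iff_exists_isStrongGenerator _ Cardinal.aleph0.{w}).2
    ⟨_, inferInstance, ModuleCat.isStrongGenerator_self R, ?_⟩
  rintro _ ⟨⟩
  exact ModuleCat.isFinitelyPresentable_of_self R

end CategoryTheory

theorem mainTheorem1 :
    (∀ (C : Type u) [Category.{w} C] [Preadditive C] [HasFiniteBiproducts C]
      [IsLocallyFinitelyPresentable.{w} C],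
      MorphismProperty.IsCofibrantlyGenerated.{w}
        (MorphismProperty.pureMonomorphisms.{w} C)) ∧
    (∀ (R : Type w) [Ring R],
      MorphismProperty.IsCofibrantlyGenerated.{w}
        (MorphismProperty.pureMonomorphisms.{w} (ModuleCat.{w} R))) :=
  ⟨fun C ↦ isCofibrantlyGenerated_pureMonomorphisms C,
    fun R ↦ isCofibrantlyGenerated_pureMonomorphisms (ModuleCat.{w} R)⟩
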